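/- Let $G$ be a finite simple graph on a vertex set $V=\{x_1,\dots,x_n\}$ and let $k_1,\dots,k_n\ge 2$ be integers. Let $G'$ be the graph obtained from $G$ by attaching, for each $i$, a complete graph $K_{k_i}$ to $x_i$; that is, one takes complete graphs $K_{k_1},\dots,K_{k_n}$ on pairwise disjoint vertex sets and identifies one vertex of $K_{k_i}$ with $x_i$ for each $i$ (so $G'$ has $k_1+\cdots+k_n$ vertices). Then $G'$ is unmixed and vertex decomposable. In particular, $G'$ is shellable, and it is Cohen–Macaulay over every field. Here a finite simple graph $H$ is *unmixed* if all its minimal vertex covers have the same cardinality. It is *vertex decomposable* or *shellable* if the clique complex $\Delta(\overline H)$ of its complementary graph is so. It is *Cohen–Macaulay* over a field $K$ if $S/I(H)$ is a Cohen–Macaulay ring, where $S$ is the polynomial ring over $K$ whose variables are the vertices of $H$ and $I(H)=(xy : \{x,y\}\in E(H))$ is the edge ideal. A simplicial complex $\Delta$ is *vertex decomposable* if it is a simplex (possibly $\{\emptyset\}$), or if it has a vertex $x$ such that $\Delta\setminus x=\{\sigma\in\Delta : x\notin\sigma\}$ and $\mathrm{link}_\Delta(x)=\{\sigma\in\Delta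 : x\notin\sigma,\ \sigma\cup\{x\}\in\Delta\}$ are vertex decomposable and no face of $\mathrm{link}_\Delta(x)$ is a facet of $\Delta\setminus x$. It is *shellable* if its facets can be listed as $F_1,\dots,F_s$ (without repetition) so that, for $1<i\le s$, the complex $\bigl(\bigcup_{j<i}\langle F_j\rangle\bigr)\cap\langle F_i\rangle$ is pure of dimension $\dim F_i-1$, where $\langle F\rangle$ is the set of all subsets of $F$. -/

import Mathlib

namespace CliqueAttach

universe u v

/-- An abstract simplicial complex with vertices among `V`: a family of finite sets which contains
the empty face and is closed under passing to subsets.  (Not every element of `V` has to be a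
vertex: deletions and links are complexes on fewer vertices.) -/
@[ext]
structure Complex (V : Type u) where
  faces : Set (Finset V)
  empty_mem : ∅ ∈ faces
  down_closed : ∀ {s t : Finset V}, s ∈ faces → t ⊆ s → t ∈ faces

namespace Complex

variable {V : Type u}

/-- A facet is a face which is maximal with respect to inclusion. -/
def IsFacet (Δ : Complex V) (s : Finset V) : Prop := Maximal (· ∈ Δ.faces) s

/-- `Δ` is a simplex: its faces are all the subsets of one finite set. -/
def IsSimplex (Δ : Complex V) : Prop := ∃ F : Finset V, Δ.faces = {s | s ⊆ F}

/-- The deletion `Δ \ x = {σ ∈ Δ : x ∉ σ}`. -/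
def deletion (Δ : Complex V) (x : V) : Complex V where
  faces := {s | s ∈ Δ.faces ∧ x ∉ s}
  empty_mem := ⟨Δ.empty_mem, Finset.notMem_empty x⟩
  down_closed := fun hs hts => ⟨Δ.down_closed hs.1 hts, fun hx => hs.2 (hts hx)⟩

/-- The link of a vertex `x` of `Δ`: the sets `σ` with `x ∉ σ` and `σ ∪ {x} ∈ Δ`
(such a `σ` is automatically a face of `Δ`). -/
def link (Δ : Complex V) (x : V) (hx : {x} ∈ Δ.faces) : Complex V where
  faces := {s | ∃ h : x ∉ s, Finset.cons x s h ∈ Δ.faces}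
  empty_mem := ⟨Finset.notMem_empty x, by simpa using hx⟩
  down_closed := by
    rintro s t ⟨h, hs⟩ hts
    exact ⟨fun hx' => h (hts hx'), Δ.down_closed hs (Finset.cons_subset_cons.2 hts)⟩

/-- Vertex decomposability (not necessarily pure): `Δ` is a simplex, or some vertex `x` has
vertex decomposable deletion and link, and no face of the link is a facet of the deletion. -/
inductive IsVertexDecomposable : Complex V → Prop
  | simplex (Δ : Complex V) (h : Δ.IsSimplex) : IsVertexDecomposable Δ
  | shed (Δ : Complex V) (x : V) (hx : {x} ∈ Δ.faces)
      (hdel : IsVertexDecomposable (Δ.deletion x))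
      (hlink : IsVertexDecomposable (Δ.link x hx))
      (hfacet : ∀ s ∈ (Δ.link x hx).faces, ¬ (Δ.deletion x).IsFacet s) :
      IsVertexDecomposable Δ

/-- The dimension of a face: its cardinality minus one. -/
def dimFace (s : Finset V) : ℤ := (s.card : ℤ) - 1

/-- The full simplex `⟨F⟩` on `F`, as a family of faces. -/
def simplexOn (F : Finset V) : Set (Finset V) := {s | s ⊆ F}

/-- A family of faces is pure of dimension `d`: all its maximal members have dimension `d`. -/
def IsPureOfDim (S : Set (Finset V)) (d : ℤ) : Prop :=
  ∀ s, Maximal (· ∈ S) s → dimFace s = d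

/-- Shellability (not necessarily pure): the facets can be listed without repetition as
`F 0, F 1, …` so that, for every index `i` other than the first,
`(⋃ j < i, ⟨F j⟩) ∩ ⟨F i⟩` is pure of dimension `dim (F i) - 1`. -/
def IsShellable (Δ : Complex V) : Prop :=
  ∃ (m : ℕ) (F : Fin m → Finset V), Function.Injective F ∧
    (∀ s, Δ.IsFacet s ↔ ∃ i, F i = s) ∧
    ∀ i : Fin m, 0 < (i : ℕ) →
      IsPureOfDim ((⋃ j : {j : Fin m // j < i}, simplexOn (F j)) ∩ simplexOn (F i))
        (dimFace (F i) - 1)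

end Complex

section Graph

variable {V : Type u}

/-- The clique complex of a graph: its faces are the finite cliques. -/
def cliqueComplex (G : SimpleGraph V) : Complex V where
  faces := {s | G.IsClique (s : Set V)}
  empty_mem := by simp
  down_closed := fun hs hts => Set.Pairwise.mono (Finset.coe_subset.2 hts) hs

/-- All minimal vertex covers have the same cardinality. -/
def IsUnmixed (G : SimpleGraph V) : Prop :=
  ∀ C D : Set V, Minimal G.IsVertexCover C → Minimal G.IsVertexCover D → C.encard = D.encard

/-- A graph is vertex decomposable if the clique complex of its complement is. -/
def IsVertexDecomposable (G : SimpleGraph V) : Prop := (cliqueComplex Gᶜ).IsVertexDecomposable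

/-- A graph is shellable if the clique complex of its complement is. -/
def IsShellable (G : SimpleGraph V) : Prop := (cliqueComplex Gᶜ).IsShellable

/-- The edge ideal of `G` in the polynomial ring over `K` with one variable for each vertex. -/
noncomputable def edgeIdeal (K : Type v) [Field K] (G : SimpleGraph V) : Ideal (MvPolynomial V K) :=
  Ideal.span {p | ∃ i j : V, G.Adj i j ∧ p = MvPolynomial.X i * MvPolynomial.X j}

/-- The graph obtained from `G` by attaching to each vertex `i` a complete graph on `k i` vertices,
one of which is identified with `i`.  The vertices of the complete graph attached to `i` are the
pairs `⟨i, a⟩` with `a < k i`, and `⟨i, 0⟩` is the vertex `i` of `G`. (Meant for `1 ≤ k i`.) -/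
def attachComplete (G : SimpleGraph V) (k : V → ℕ) : SimpleGraph (Σ i : V, Fin (k i)) where
  Adj p q := (p.1 = q.1 ∧ p ≠ q) ∨ (G.Adj p.1 q.1 ∧ (p.2 : ℕ) = 0 ∧ (q.2 : ℕ) = 0)
  symm := ⟨by
    rintro p q (⟨h, h'⟩ | ⟨h, hp, hq⟩)
    · exact Or.inl ⟨h.symm, h'.symm⟩
    · exact Or.inr ⟨h.symm, hq, hp⟩⟩
  loopless := ⟨by
    rintro p (⟨-, h⟩ | ⟨h, -⟩)
    · exact h rfl
    · exact G.loopless.irrefl _ h⟩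

end Graph

section CohenMacaulay

/-- The depth of a local ring: the supremum of the lengths of the regular sequences in its
maximal ideal. -/
noncomputable def localDepth (R : Type u) [CommRing R] [IsLocalRing R] : ℕ∞ :=
  ⨆ rs : {rs : List R //
    (∀ r ∈ rs, r ∈ IsLocalRing.maximalIdeal R) ∧ RingTheory.Sequence.IsRegular R rs},
    (rs.1.length : ℕ∞)

/-- A commutative ring is Cohen--Macaulay if it is Noetherian and its localization at each maximal
ideal has depth equal to its Krull dimension. -/
structure IsCohenMacaulayRing (R : Type u) [CommRing R] : Prop where
  noetherian : IsNoetherianRing R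
  depth_eq : ∀ (M : Ideal R) [M.IsMaximal],
    ((localDepth (Localization.AtPrime M) : ℕ∞) : WithBot ℕ∞) =
      ringKrullDim (Localization.AtPrime M)

/-- A graph is Cohen--Macaulay over the field `K` if the polynomial ring modulo the edge ideal
is a Cohen--Macaulay ring. -/
def IsCohenMacaulayOver {V : Type u} (K : Type v) [Field K] (G : SimpleGraph V) : Prop :=
  IsCohenMacaulayRing (MvPolynomial V K ⧸ edgeIdeal K G)

end CohenMacaulay

end CliqueAttach

/-!
The attached complete graphs partition the vertices of `G'` into cliques, and since `k i ≥ 2` each of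
them has a simplicial vertex: one whose neighbours all lie in its own clique. Colouring each vertex
by its clique, this is the situation of `IsSimplicialPartition`, and everything is proved for graphs
with such a colouring, by induction over induced subgraphs: if `x ≠ b` lie in one clique and `b` is
simplicial, then deleting `x`, or deleting the neighbours of `x`, preserves the situation, and when
no such pair is left there are no edges.

* A maximal independent set meets each clique exactly once, which gives unmixedness.
* Such an `x` is a shedding vertex of the independence complex, because an independent set avoiding
  `x` and its neighbours can be enlarged by `b`. This gives vertex decomposability, and
  `Complex.IsVertexDecomposable.isShellable` derives shellability for every finite complex.
* For the Cohen–Macaulay property let `θ_i` be the sum of the variables of colour `i` and let `M` be a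
  maximal ideal of the edge ring `R`. By Zariski's lemma there are monic polynomials `f_i` over `K`
  with `f_i(θ_i) ∈ M`. They form a weakly regular sequence on `R`: by the sequences
  `0 → S/(I : x) → S/I → S/(I, x) → 0` (`isWeaklyRegular_quotient_of_colon`), whose outer terms are
  again rings of the same kind, this reduces to the edgeless case, where `R` is a polynomial ring with
  variables `θ_i`. Hence the depth of `R_M` is at least the number of colours. Conversely the relations
  `x_p ^ 2 = x_p θ_{c p}` make `R` modulo the `f_i(θ_i)` integral over `K`, so that `M` is minimal over
  them and Krull's height theorem bounds the dimension of `R_M` by the number of colours. As depth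
  never exceeds dimension, both are equal.
-/

namespace CliqueAttach

universe u v w

open RingTheory.Sequence Function

/-! ### Partitions into cliques with a simplicial vertex -/

section Partition

variable {P : Type u} {V : Type v}

/-- The vertices of `H` are coloured by `c` so that each colour class is a clique, `T` is the set of
colours occurring in `W`, and for each `i ∈ T` the set `W` contains a vertex of colour `i` whose
neighbours in `W` all have colour `i` (a simplicial vertex of the subgraph induced on `W`). -/
structure IsSimplicialPartition (H : SimpleGraph P) (c : P → V) (W : Set P) (T : Set V) :
    Prop where
  adj_of_eq : ∀ ⦃p q⦄, c p = c q → p ≠ q → H.Adj p q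
  color_mem : ∀ p ∈ W, c p ∈ T
  exists_simplicial : ∀ i ∈ T, ∃ b ∈ W, c b = i ∧ ∀ q ∈ W, H.Adj b q → c q = i

namespace IsSimplicialPartition

variable {H : SimpleGraph P} {c : P → V} {W : Set P} {T : Set V}

theorem diff_singleton (h : IsSimplicialPartition H c W T) {x b : P}
    (hbW : b ∈ W) (hbx : b ≠ x) (hc : c b = c x)
    (hb : ∀ q ∈ W, H.Adj b q → c q = c b) : IsSimplicialPartition H c (W \ {x}) T where
  adj_of_eq := h.adj_of_eq
  color_mem p hp := h.color_mem p hp.1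
  exists_simplicial i hi := by
    obtain ⟨a, haW, hai, ha⟩ := h.exists_simplicial i hi
    by_cases hax : a = x
    · subst hax
      exact ⟨b, ⟨hbW, hbx⟩, hc.trans hai, fun q hq hbq => (hb q hq.1 hbq).trans (hc.trans hai)⟩
    · exact ⟨a, ⟨haW, hax⟩, hai, fun q hq => ha q hq.1⟩

/-- The colour of `x` survives, since `x` itself becomes isolated; a simplicial vertex of another
colour is not a neighbour of `x`. -/
theorem diff_neighborSet (h : IsSimplicialPartition H c W T) {x : P} (hx : x ∈ W) :
    IsSimplicialPartition H c (W \ H.neighborSet x) T where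
  adj_of_eq := h.adj_of_eq
  color_mem p hp := h.color_mem p hp.1
  exists_simplicial i hi := by
    by_cases hxi : c x = i
    · exact ⟨x, ⟨hx, fun hxx => H.loopless.irrefl x hxx⟩, hxi,
        fun q hq hxq => absurd hxq hq.2⟩
    · obtain ⟨a, haW, hai, ha⟩ := h.exists_simplicial i hi
      exact ⟨a, ⟨haW, fun hxa => hxi (ha x hx (H.adj_symm hxa))⟩, hai, fun q hq => ha q hq.1⟩

theorem diff_closedNeighborSet (h : IsSimplicialPartition H c W T) {x : P} (hx : x ∈ W) :
    IsSimplicialPartition H c (W \ insert x (H.neighborSet x)) (T \ {c x}) where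
  adj_of_eq := h.adj_of_eq
  color_mem p hp := ⟨h.color_mem p hp.1, fun hpx => by
    have hpx' : p ≠ x := fun e => hp.2 (Or.inl e)
    exact hp.2 (Or.inr (h.adj_of_eq (Eq.symm hpx) hpx'.symm))⟩
  exists_simplicial i hi := by
    obtain ⟨a, haW, hai, ha⟩ := h.exists_simplicial i hi.1
    refine ⟨a, ⟨haW, ?_⟩, hai, fun q hq => ha q hq.1⟩
    rintro (rfl | hxa)
    · exact hi.2 hai.symm
    · exact hi.2 (ha x hx (H.adj_symm hxa)).symm

theorem not_adj_of_injOn (h : IsSimplicialPartition H c W T) (hinj : Set.InjOn c W)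
    {p q : P} (hp : p ∈ W) (hq : q ∈ W) : ¬ H.Adj p q := by
  intro hpq
  obtain ⟨a, haW, hai, ha⟩ := h.exists_simplicial _ (h.color_mem p hp)
  obtain rfl := hinj haW hp hai
  exact hpq.ne (hinj hp hq (ha q hq hpq).symm)

/-- If some colour occurs twice in `W`, then `W` contains a vertex `x` together with a simplicial
vertex `b ≠ x` of the same colour. -/
theorem exists_shed (h : IsSimplicialPartition H c W T) (hinj : ¬ Set.InjOn c W) :
    ∃ x ∈ W, ∃ b ∈ W, b ≠ x ∧ c b = c x ∧ ∀ q ∈ W, H.Adj b q → c q = c b := by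
  simp only [Set.InjOn, not_forall] at hinj
  obtain ⟨p, hp, q, hq, hpq, hne⟩ := hinj
  obtain ⟨a, haW, hai, ha⟩ := h.exists_simplicial _ (h.color_mem p hp)
  by_cases hap : a = p
  · subst hap
    exact ⟨q, hq, a, haW, hne, hpq, ha⟩
  · exact ⟨p, hp, a, haW, hap, hai, fun q hq hadj => (ha q hq hadj).trans hai.symm⟩

/-- The complement of a minimal vertex cover meets each colour class in exactly one vertex, so its
cardinality is the number of colours. -/
theorem isUnmixed [Finite P] (h : IsSimplicialPartition H c Set.univ Set.univ) :
    IsUnmixed H := by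
  have key : ∀ C : Set P, Minimal H.IsVertexCover C → Cᶜ.encard = (Set.univ : Set V).encard := by
    intro C hC
    have hind : ∀ p ∈ Cᶜ, ∀ q ∈ Cᶜ, ¬ H.Adj p q := by
      intro p hp q hq hpq
      rcases hC.prop hpq with h1 | h1
      · exact hp h1
      · exact hq h1
    have hinj : Set.InjOn c Cᶜ := by
      intro p hp q hq hpq
      by_contra hne
      exact hind p hp q hq (h.adj_of_eq hpq hne)
    rw [← hinj.encard_image]
    congr 1
    refine Set.eq_univ_of_forall fun i => ?_
    obtain ⟨b, -, hbi, hb⟩ := h.exists_simplicial i trivial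
    by_contra hi
    have hmem : ∀ q, c q = i → q ∈ C := fun q hq => by
      by_contra hqC
      exact hi ⟨q, hqC, hq⟩
    -- a cover containing the whole class of `b` does not need `b`
    have hcov : H.IsVertexCover (C \ {b}) := by
      intro p q hpq
      by_cases hpb : p = b
      · subst hpb
        exact Or.inr ⟨hmem q (hb q trivial hpq), fun e => hpq.ne (Eq.symm e)⟩
      · by_cases hqb : q = b
        · subst hqb
          exact Or.inl ⟨hmem p (hb p trivial hpq.symm), hpb⟩
        · rcases hC.prop hpq with h1 | h1
          · exact Or.inl ⟨h1, hpb⟩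
          · exact Or.inr ⟨h1, hqb⟩
    exact (hC.le_of_le hcov Set.sdiff_subset (hmem b hbi)).2 rfl
  intro C D hC hD
  have hfin : (Cᶜ).encard ≠ ⊤ := (Set.toFinite Cᶜ).encard_lt_top.ne
  have h1 := Set.encard_add_encard_compl C
  have h2 := Set.encard_add_encard_compl D
  rw [key D hD, ← key C hC, ← h1] at h2
  exact ((ENat.add_left_injective_of_ne_top hfin) h2).symm

end IsSimplicialPartition

/-! ### Independence complexes and vertex decomposability -/

/-- The complex of the independent sets of `H` which are contained in `W`. -/
def indepComplexOn (H : SimpleGraph P) (W : Set P) : Complex P where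
  faces := {s | (s : Set P) ⊆ W ∧ H.IsIndepSet (s : Set P)}
  empty_mem := by simp
  down_closed := fun hs hts =>
    ⟨(Finset.coe_subset.2 hts).trans hs.1, Set.Pairwise.mono (Finset.coe_subset.2 hts) hs.2⟩

theorem cliqueComplex_compl (H : SimpleGraph P) :
    cliqueComplex Hᶜ = indepComplexOn H Set.univ := by
  ext s
  simp [cliqueComplex, indepComplexOn]

theorem singleton_mem_indepComplexOn {H : SimpleGraph P} {W : Set P} {x : P} (hx : x ∈ W) :
    {x} ∈ (indepComplexOn H W).faces := by
  simp [indepComplexOn, hx, SimpleGraph.IsIndepSet]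

theorem deletion_indepComplexOn (H : SimpleGraph P) (W : Set P) (x : P) :
    (indepComplexOn H W).deletion x = indepComplexOn H (W \ {x}) := by
  ext s
  simp only [indepComplexOn, Complex.deletion, Set.mem_ofPred_eq, Set.subset_sdiff,
    Set.disjoint_singleton_right, Finset.mem_coe]
  tauto

theorem isIndepSet_insert_iff {H : SimpleGraph P} {s : Set P} {x : P} :
    H.IsIndepSet (insert x s) ↔ H.IsIndepSet s ∧ Disjoint s (H.neighborSet x) := by
  simp only [SimpleGraph.IsIndepSet, Set.pairwise_insert, Set.disjoint_left,
    SimpleGraph.mem_neighborSet]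
  refine and_congr_right fun _ => ⟨fun h a ha hxa => (h a ha hxa.ne).1 hxa, fun h a ha _ =>
    ⟨h ha, fun hax => h ha hax.symm⟩⟩

theorem link_indepComplexOn (H : SimpleGraph P) (W : Set P) {x : P} (hxW : x ∈ W)
    (hx : {x} ∈ (indepComplexOn H W).faces) :
    (indepComplexOn H W).link x hx = indepComplexOn H (W \ insert x (H.neighborSet x)) := by
  ext s
  simp only [indepComplexOn, Complex.link, Set.mem_ofPred_eq, Finset.coe_cons,
    isIndepSet_insert_iff, Set.insert_subset_iff, Set.subset_sdiff, Set.disjoint_insert_right,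
    exists_prop, Finset.mem_coe]
  tauto

/-- Any vertex `x ∈ W` which shares its colour with a simplicial vertex `b ≠ x` is a shedding
vertex; if there is none, `W` is independent and the complex is a simplex. -/
theorem IsSimplicialPartition.isVertexDecomposable_indepComplexOn [Finite P]
    {H : SimpleGraph P} {c : P → V} {W : Set P} {T : Set V}
    (h : IsSimplicialPartition H c W T) : (indepComplexOn H W).IsVertexDecomposable := by
  induction W using WellFoundedLT.induction generalizing T with
  | ind W ih =>
  by_cases hinj : Set.InjOn c W
  · refine .simplex _ ⟨(Set.toFinite W).toFinset, ?_⟩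
    ext s
    simp only [indepComplexOn, Set.mem_ofPred_eq, Set.Finite.subset_toFinset, and_iff_left_iff_imp]
    exact fun hs p hp q hq _ => h.not_adj_of_injOn hinj (hs hp) (hs hq)
  · obtain ⟨x, hx, b, hbW, hbx, hc, hb⟩ := h.exists_shed hinj
    have hxb : H.Adj x b := h.adj_of_eq hc.symm hbx.symm
    refine .shed _ x (singleton_mem_indepComplexOn hx) ?_ ?_ ?_
    · rw [deletion_indepComplexOn]
      exact ih _ ⟨Set.sdiff_subset, fun hle => (hle hx).2 rfl⟩ (h.diff_singleton hbW hbx hc hb)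
    · rw [link_indepComplexOn H W hx]
      exact ih _ ⟨Set.sdiff_subset, fun hle => (hle hx).2 (Or.inl rfl)⟩
        (h.diff_closedNeighborSet hx)
    · classical
      -- a face of the link can be enlarged by `b`, as the neighbours of `b` in `W` other than `x`
      -- are neighbours of `x`
      rw [link_indepComplexOn H W hx, deletion_indepComplexOn]
      rintro s ⟨hsW, hs⟩ hfac
      have hbs : b ∉ s := fun hbs => (hsW hbs).2 (Or.inr hxb)
      refine hbs (hfac.le_of_ge (y := insert b s) ?_ (Finset.subset_insert b s)
        (Finset.mem_insert_self b s))
      refine ⟨?_, ?_⟩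
      · rw [Finset.coe_insert, Set.insert_subset_iff]
        exact ⟨⟨hbW, hbx⟩, fun p hp => ⟨(hsW hp).1, fun e => (hsW hp).2 (Or.inl e)⟩⟩
      · rw [Finset.coe_insert, isIndepSet_insert_iff]
        refine ⟨hs, Set.disjoint_left.2 fun p hp hbp => (hsW hp).2 ?_⟩
        by_cases hpx : p = x
        · exact Or.inl hpx
        · exact Or.inr (h.adj_of_eq ((hb p (hsW hp).1 hbp).trans hc).symm (Ne.symm hpx))

end Partition

/-! ### Shellability of vertex decomposable complexes -/

namespace Complex

variable {V : Type u}

/-- `L` lists the facets of `Δ` without repetition in a shelling order. -/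
structure IsShelling (Δ : Complex V) (L : List (Finset V)) : Prop where
  nodup : L.Nodup
  isFacet_iff : ∀ s, Δ.IsFacet s ↔ s ∈ L
  pure : ∀ A F B, L = A ++ F :: B → A ≠ [] →
    IsPureOfDim {s | (∃ G ∈ A, s ⊆ G) ∧ s ⊆ F} (dimFace F - 1)

theorem IsShelling.isShellable {Δ : Complex V} {L : List (Finset V)} (h : Δ.IsShelling L) :
    Δ.IsShellable := by
  refine ⟨L.length, fun i => L[i], fun i j hij => Fin.ext (h.nodup.getElem_inj_iff.1 hij),
    fun s => ?_, fun i hi => ?_⟩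
  · rw [h.isFacet_iff, List.mem_iff_get]; rfl
  · have hL : L = L.take i ++ L[i] :: L.drop (i + 1) := by simp
    have hne : L.take i ≠ [] := by
      intro e
      have := congrArg List.length e
      simp at this
      omega
    convert h.pure _ _ _ hL hne using 1
    ext s
    simp only [simplexOn, Set.mem_inter_iff, Set.mem_iUnion, Set.mem_ofPred_eq, Subtype.exists,
      List.mem_take_iff_getElem]
    refine and_congr_left fun _ => ⟨?_, ?_⟩
    · rintro ⟨j, hj, hs⟩
      exact ⟨L[j], ⟨j, lt_min hj j.2, rfl⟩, hs⟩
    · rintro ⟨_, ⟨j, hj, rfl⟩, hs⟩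
      exact ⟨⟨j, (lt_min_iff.1 hj).2⟩, (lt_min_iff.1 hj).1, hs⟩

theorem exists_isFacet_ge [Finite V] {Δ : Complex V} {s : Finset V} (hs : s ∈ Δ.faces) :
    ∃ t, s ⊆ t ∧ Δ.IsFacet t :=
  (Set.toFinite Δ.faces).exists_le_maximal hs

theorem isShelling_simplex {Δ : Complex V} (h : Δ.IsSimplex) : ∃ L, Δ.IsShelling L := by
  obtain ⟨F, hF⟩ := h
  refine ⟨[F], List.nodup_singleton F, fun s => ?_, fun A G B hL hA => ?_⟩
  · rw [List.mem_singleton, IsFacet, hF]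
    exact ⟨fun hs => le_antisymm hs.prop (hs.le_of_ge (y := F) (Finset.Subset.refl F) hs.prop),
      fun e => e ▸ ⟨Finset.Subset.refl s, fun t ht _ => ht⟩⟩
  · have := congrArg List.length hL
    have hpos := List.length_pos_iff.2 hA
    simp at this
    omega

open Classical in
/-- A shelling of `Δ` lists the facets in a shelling of the deletion of `x`, followed by the cones
with apex `x` over the facets in a shelling of the link of `x`. -/
theorem IsShelling.shed [Finite V] {Δ : Complex V} {x : V} {hx : {x} ∈ Δ.faces}
    {L₁ L₂ : List (Finset V)} (h₁ : (Δ.deletion x).IsShelling L₁)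
    (h₂ : (Δ.link x hx).IsShelling L₂)
    (hfacet : ∀ s ∈ (Δ.link x hx).faces, ¬ (Δ.deletion x).IsFacet s) :
    Δ.IsShelling (L₁ ++ L₂.map (insert x)) := by
  have mem_link : ∀ s, s ∈ (Δ.link x hx).faces ↔ x ∉ s ∧ insert x s ∈ Δ.faces := fun s => by
    simp [link]
  have hL₁ : ∀ s ∈ L₁, x ∉ s := fun s hs => ((h₁.isFacet_iff s).2 hs).prop.2
  have hL₂ : ∀ s ∈ L₂, x ∉ s ∧ insert x s ∈ Δ.faces := fun s hs =>
    (mem_link s).1 ((h₂.isFacet_iff s).2 hs).prop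
  refine ⟨?_, fun s => ?_, fun A F B hL hA => ?_⟩
  · rw [List.nodup_append]
    refine ⟨h₁.nodup, h₂.nodup.map_on fun s hs t ht e => ?_, ?_⟩
    · rw [← Finset.erase_insert (hL₂ s hs).1, e, Finset.erase_insert (hL₂ t ht).1]
    · rintro s hs t ht rfl
      obtain ⟨t, -, rfl⟩ := List.mem_map.1 ht
      exact hL₁ _ hs (Finset.mem_insert_self x t)
  · rw [List.mem_append, List.mem_map, ← h₁.isFacet_iff]
    constructor
    · intro hs
      by_cases hxs : x ∈ s
      · refine Or.inr ⟨s.erase x, (h₂.isFacet_iff _).1 ⟨(mem_link _).2 ⟨s.notMem_erase x, ?_⟩,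
          fun t ht hst => ?_⟩, Finset.insert_erase hxs⟩
        · rw [Finset.insert_erase hxs]
          exact hs.prop
        · obtain ⟨hxt, ht⟩ := (mem_link t).1 ht
          have hle := hs.le_of_ge ht (by
            rw [← Finset.insert_erase hxs]
            exact Finset.insert_subset_insert x hst)
          exact (Finset.subset_insert_iff_of_notMem hxt).1
            (show t ⊆ insert x (s.erase x) by
              rw [Finset.insert_erase hxs]
              exact (Finset.subset_insert x t).trans hle)
      · exact Or.inl ⟨⟨hs.prop, hxs⟩, fun t ht hst => hs.le_of_ge ht.1 hst⟩
    · rintro (hs | ⟨t, ht, rfl⟩)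
      · refine ⟨hs.prop.1, fun u hu hsu => ?_⟩
        by_cases hxu : x ∈ u
        · refine absurd hs (hfacet s ((mem_link s).2 ⟨hs.prop.2, Δ.down_closed hu ?_⟩))
          exact Finset.insert_subset hxu hsu
        · exact hs.le_of_ge ⟨hu, hxu⟩ hsu
      · refine ⟨(hL₂ t ht).2, fun u hu htu => ?_⟩
        have hxu : x ∈ u := htu (Finset.mem_insert_self x t)
        have hle := ((h₂.isFacet_iff t).2 ht).le_of_ge (y := u.erase x)
          ((mem_link _).2 ⟨u.notMem_erase x, by rwa [Finset.insert_erase hxu]⟩)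
          (fun a ha => Finset.mem_erase.2
            ⟨fun e => (hL₂ t ht).1 (e ▸ ha), htu (Finset.mem_insert_of_mem ha)⟩)
        rw [← Finset.insert_erase hxu]
        exact Finset.insert_subset_insert x hle
  · have hsplit : (∃ A', A = L₁ ++ A' ∧ L₂.map (insert x) = A' ++ F :: B) ∨
        ∃ B', L₁ = A ++ F :: B' := by
      rcases List.append_eq_append_iff.1 hL with h | ⟨_ | ⟨F', B'⟩, hA', hB⟩
      · exact Or.inl h
      · exact Or.inl ⟨[], by simpa using hA'.symm, by simpa using hB.symm⟩
      · obtain ⟨rfl, rfl⟩ := List.cons.inj hB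
        exact Or.inr ⟨B', hA'⟩
    rcases hsplit with ⟨A', rfl, hA'⟩ | ⟨B', hB'⟩
    · obtain ⟨A₂, R, rfl, rfl, hR⟩ := List.map_eq_append_iff.1 hA'
      obtain ⟨F₂, B₂, rfl, rfl, -⟩ := List.map_eq_cons_iff.1 hR
      have hF := hL₂ F₂ (by simp)
      have hdim : dimFace (insert x F₂) = dimFace F₂ + 1 := by
        simp [dimFace, Finset.card_insert_of_notMem hF.1]
      intro s hs
      -- a maximal face `s` of the intersection without `x` equals `F₂`, which lies in a facet of the
      -- deletion; one with `x` comes from a maximal face of the intersection in the link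
      by_cases hxs : x ∈ s
      · obtain ⟨⟨G, hG, hsG⟩, hsF⟩ := hs.prop
        have hGA : G ∈ A₂.map (insert x) := by
          refine (List.mem_append.1 hG).resolve_left fun hG₁ => hL₁ G hG₁ (hsG hxs)
        obtain ⟨G₂, hG₂, rfl⟩ := List.mem_map.1 hGA
        have hpure := h₂.pure A₂ F₂ B₂ rfl (List.ne_nil_of_mem hG₂) (s.erase x)
          ⟨⟨⟨G₂, hG₂, ?_⟩, ?_⟩, ?_⟩
        · have hcard := Finset.card_erase_add_one hxs
          simp only [dimFace] at hpure hdim ⊢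
          omega
        · exact Finset.subset_insert_iff.1 hsG
        · exact Finset.subset_insert_iff.1 hsF
        · rintro t ⟨⟨G', hG', htG'⟩, htF⟩ hst
          have hle := hs.le_of_ge (y := insert x t) ⟨⟨insert x G',
            List.mem_append_right _ (List.mem_map_of_mem hG'), Finset.insert_subset_insert x htG'⟩,
            Finset.insert_subset_insert x htF⟩ (Finset.subset_insert_iff.2 hst)
          exact fun a ha => Finset.mem_erase.2 ⟨fun e => hF.1 (e ▸ htF ha),
            hle (Finset.mem_insert_of_mem ha)⟩
      · have hsF : s ⊆ F₂ := (Finset.subset_insert_iff_of_notMem hxs).1 hs.prop.2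
        obtain ⟨G, hFG, hG⟩ := exists_isFacet_ge (Δ := Δ.deletion x) (s := F₂)
          ⟨Δ.down_closed hF.2 (Finset.subset_insert x F₂), hF.1⟩
        have hle := hs.le_of_ge (y := F₂) ⟨⟨G, List.mem_append_left _ ((h₁.isFacet_iff G).1 hG),
          hFG⟩, Finset.subset_insert x F₂⟩ hsF
        rw [Finset.Subset.antisymm hsF hle, hdim, add_sub_cancel_right]
    · exact h₁.pure A F B' hB' hA

theorem IsVertexDecomposable.isShellable [Finite V] {Δ : Complex V}
    (h : Δ.IsVertexDecomposable) : Δ.IsShellable := by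
  suffices ∃ L, Δ.IsShelling L from this.elim fun _ hL => hL.isShellable
  induction h with
  | simplex Δ h => exact isShelling_simplex h
  | shed Δ x hx _ _ hfacet ih₁ ih₂ =>
    obtain ⟨L₁, h₁⟩ := ih₁
    obtain ⟨L₂, h₂⟩ := ih₂
    exact ⟨_, h₁.shed h₂ hfacet⟩

end Complex

/-! ### Weakly regular sequences -/

section WeaklyRegular

/-- Weak regularity passes from the ends of a short exact sequence to its middle term. -/
theorem isWeaklyRegular_of_exact {R : Type*} [CommRing R] {M M' M'' : Type*}
    [AddCommGroup M] [AddCommGroup M'] [AddCommGroup M''] [Module R M] [Module R M']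
    [Module R M''] {f : M →ₗ[R] M'} {g : M' →ₗ[R] M''} (hf : Injective f) (hfg : Exact f g)
    (hg : Surjective g) {rs : List R} (h : IsWeaklyRegular M rs) (h'' : IsWeaklyRegular M'' rs) :
    IsWeaklyRegular M' rs := by
  induction rs generalizing M M' M'' with
  | nil => exact .nil R M'
  | cons r rs ih =>
    rw [isWeaklyRegular_cons_iff] at h h'' ⊢
    refine ⟨isSMulRegular_of_range_eq_ker hf hfg.linearMap_ker_eq.symm h.1 h''.1,
      ih ?_ (QuotSMulTop.map_exact r hfg hg) (QuotSMulTop.map_surjective r hg) h.2 h''.2⟩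
    have h0 : Exact (0 : M →ₗ[R] M) f := (LinearMap.exact_zero_iff_injective M f).2 hf
    have h1 := QuotSMulTop.map_first_exact_on_four_term_exact_of_isSMulRegular_last h0 hfg h''.1
    rw [map_zero] at h1
    exact (LinearMap.exact_zero_iff_injective _ _).1 h1

open Polynomial in
/-- A monic polynomial extends a weakly regular sequence of constants, because it stays monic, hence
a nonzerodivisor, over the quotient of `A` by those constants. -/
theorem isWeaklyRegular_map_C_append_monic {A : Type*} [CommRing A] {rs : List A}
    (h : IsWeaklyRegular A rs) {f : A[X]} (hf : f.Monic) :
    IsWeaklyRegular A[X] (rs.map C ++ [f]) := by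
  rw [isWeaklyRegular_append_iff, isWeaklyRegular_singleton_iff]
  refine ⟨h.of_flat (S := A[X]), ?_⟩
  rw [isSMulRegular_quotient_iff_mem_of_smul_mem, ← Ideal.map_ofList, smul_eq_mul, Ideal.mul_top]
  intro p hp
  set J := Ideal.ofList rs
  have key : ∀ q : A[X], q ∈ J.map C ↔ q.map (Ideal.Quotient.mk J) = 0 := fun q => by
    simp [Ideal.mem_map_C_iff, Polynomial.ext_iff, Ideal.Quotient.eq_zero_iff_mem]
  rw [key, smul_eq_mul, Polynomial.map_mul] at hp
  rw [key]
  exact (hf.map _).mul_right_eq_zero_iff.1 hp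

open MvPolynomial in
/-- Monic polynomials, each in its own variable, form a weakly regular sequence in some order `l`
of the variables; only the length of `l` is recorded. -/
theorem exists_isWeaklyRegular_aeval_X (K : Type*) [CommRing K] (V : Type u) [Finite V]
    (f : V → Polynomial K) (hf : ∀ i, (f i).Monic) :
    ∃ l : List V, l.length = Nat.card V ∧
      IsWeaklyRegular (MvPolynomial V K)
        (l.map fun i => Polynomial.aeval (X i : MvPolynomial V K) (f i)) := by
  induction V using Finite.induction_empty_option with
  | of_equiv e ih =>
    obtain ⟨l, hl, h⟩ := ih (fun i => f (e i)) (fun i => hf _)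
    refine ⟨l.map e, by rw [List.length_map, hl, Nat.card_congr e], ?_⟩
    refine ((renameEquiv K e).toAddEquiv.isWeaklyRegular_congr ?_).1 h
    rw [List.map_map, List.forall₂_map_left_iff, List.forall₂_map_right_iff, List.forall₂_same]
    intro i _ p
    simp
  | h_empty => exact ⟨[], by simp, .nil _ _⟩
  | @h_option V _ ih =>
    obtain ⟨l, hl, h⟩ := ih (fun i => f (some i)) (fun i => hf _)
    refine ⟨l.map some ++ [none], by simp [hl], ?_⟩
    have h' := isWeaklyRegular_map_C_append_monic h
      ((hf none).map (algebraMap K (MvPolynomial V K)))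
    have heq : (l.map some ++ [none]).map (fun i => optionEquivLeft K V
        (Polynomial.aeval (X i : MvPolynomial (Option V) K) (f i))) =
        (l.map fun i => Polynomial.aeval (X i : MvPolynomial V K) (f (some i))).map Polynomial.C ++
          [(f none).map (algebraMap K (MvPolynomial V K))] := by
      simp only [List.map_append, List.map_map, List.map_cons, List.map_nil]
      congr 1
      · refine List.map_congr_left fun i _ => ?_
        simp only [comp_apply, ← Polynomial.aeval_algHom_apply, optionEquivLeft_X_some]
        exact Polynomial.aeval_algHom_apply
          (Algebra.ofId (MvPolynomial V K) _ |>.restrictScalars K) (X i) (f (some i))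
      · rw [← Polynomial.aeval_algHom_apply, optionEquivLeft_X_none,
          Polynomial.aeval_X_left_eq_map]
    rw [← heq] at h'
    refine ((optionEquivLeft K V).toAddEquiv.isWeaklyRegular_congr ?_).2 h'
    rw [List.forall₂_map_left_iff, List.forall₂_map_right_iff, List.forall₂_same]
    intro i _ p
    simp

/-- The short exact sequence `0 → S/(I : x) → S/I → S/(I, x) → 0`. -/
theorem isWeaklyRegular_quotient_of_colon {S : Type*} [CommRing S] {I J J' : Ideal S} {x : S}
    (hJ : ∀ p, x * p ∈ I ↔ p ∈ J) (hJ' : J' = I ⊔ Ideal.span {x}) {rs : List S}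
    (h : IsWeaklyRegular (S ⧸ J) rs) (h' : IsWeaklyRegular (S ⧸ J') rs) :
    IsWeaklyRegular (S ⧸ I) rs := by
  have hle : I ≤ Submodule.comap LinearMap.id J' := hJ' ▸ le_sup_left
  have hle' : J ≤ Submodule.comap (LinearMap.mulLeft S x) I := fun p hp => (hJ p).2 hp
  refine isWeaklyRegular_of_exact
    (f := Submodule.mapQ J I (LinearMap.mulLeft S x) hle')
    (g := Submodule.mapQ I J' LinearMap.id hle) ?_ ?_ ?_ h h'
  · rw [← LinearMap.ker_eq_bot, LinearMap.ker_eq_bot']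
    intro p hp
    obtain ⟨p, rfl⟩ := Submodule.mkQ_surjective _ p
    rw [Submodule.mkQ_apply, Submodule.mapQ_apply, Submodule.Quotient.mk_eq_zero] at hp
    exact (Submodule.Quotient.mk_eq_zero _).2 ((hJ p).1 hp)
  · intro p
    obtain ⟨p, rfl⟩ := Submodule.mkQ_surjective _ p
    simp only [Submodule.mkQ_apply, Submodule.mapQ_apply, LinearMap.id_apply,
      Submodule.Quotient.mk_eq_zero, Set.mem_range]
    rw [hJ', Submodule.mem_sup]
    constructor
    · rintro ⟨y, hy, z, hz, rfl⟩
      obtain ⟨a, rfl⟩ := Ideal.mem_span_singleton'.1 hz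
      refine ⟨Submodule.Quotient.mk a, ?_⟩
      rw [Submodule.mapQ_apply, Submodule.Quotient.eq, LinearMap.mulLeft_apply]
      have : x * a - (y + a * x) = -y := by ring
      rw [this]
      exact I.neg_mem hy
    · rintro ⟨q, hq⟩
      obtain ⟨a, rfl⟩ := Submodule.mkQ_surjective _ q
      rw [Submodule.mkQ_apply, Submodule.mapQ_apply, Submodule.Quotient.eq,
        LinearMap.mulLeft_apply] at hq
      exact ⟨p - x * a, by simpa using I.neg_mem hq, x * a,
        Ideal.mem_span_singleton'.2 ⟨a, mul_comm a x⟩, sub_add_cancel _ _⟩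
  · intro p
    obtain ⟨p, rfl⟩ := Submodule.mkQ_surjective _ p
    exact ⟨Submodule.Quotient.mk p, rfl⟩

end WeaklyRegular

/-! ### Stanley–Reisner ideals -/

section StanleyReisner

open MvPolynomial

variable {P : Type u}

/-- The Stanley–Reisner ideal, spanned by all monomials whose support is not a face of `Δ`. -/
noncomputable def stanleyReisnerIdeal (K : Type w) [Field K] (Δ : Complex P) :
    Ideal (MvPolynomial P K) :=
  Ideal.span ((fun m => monomial m (1 : K)) '' {m | m.support ∉ Δ.faces})

theorem mem_stanleyReisnerIdeal {K : Type w} [Field K] {Δ : Complex P} {p : MvPolynomial P K} :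
    p ∈ stanleyReisnerIdeal K Δ ↔ ∀ m ∈ p.support, m.support ∉ Δ.faces := by
  rw [stanleyReisnerIdeal, mem_ideal_span_monomial_image]
  refine forall₂_congr fun m _ => ⟨?_, fun h => ⟨m, h, le_rfl⟩⟩
  rintro ⟨n, hn, hnm⟩ hm
  exact hn (Δ.down_closed hm (Finsupp.support_mono hnm))

theorem edgeIdeal_eq_stanleyReisnerIdeal (K : Type w) [Field K] (H : SimpleGraph P) :
    edgeIdeal K H = stanleyReisnerIdeal K (indepComplexOn H Set.univ) := by
  classical
  apply le_antisymm
  · refine Ideal.span_le.2 ?_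
    rintro _ ⟨i, j, hij, rfl⟩
    rw [SetLike.mem_coe, mem_stanleyReisnerIdeal]
    have : (X i * X j : MvPolynomial P K) =
        monomial (Finsupp.single i 1 + Finsupp.single j 1) 1 := by
      simp [X, monomial_mul]
    intro m hm hface
    rw [this] at hm
    obtain rfl := Finset.mem_singleton.1 (support_monomial_subset hm)
    exact hface.2 (x := i) (by simp) (y := j) (by simp) hij.ne hij
  · refine Ideal.span_le.2 ?_
    rintro _ ⟨m, hm, rfl⟩
    have : ∃ i ∈ m.support, ∃ j ∈ m.support, H.Adj i j := by
      by_contra! hcon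
      exact hm ⟨Set.subset_univ _, fun i hi j hj _ => hcon i hi j hj⟩
    obtain ⟨i, hi, j, hj, hij⟩ := this
    refine Ideal.mem_of_dvd _ ?_ (Ideal.subset_span ⟨i, j, hij, rfl⟩)
    have : (X i * X j : MvPolynomial P K) =
        monomial (Finsupp.single i 1 + Finsupp.single j 1) 1 := by
      simp [X, monomial_mul]
    rw [this]
    refine monomial_dvd_monomial.2 ⟨Or.inr fun a => ?_, one_dvd _⟩
    have hi' : m i ≠ 0 := Finsupp.mem_support_iff.1 hi
    have hj' : m j ≠ 0 := Finsupp.mem_support_iff.1 hj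
    have hne := hij.ne
    simp only [Finsupp.add_apply, Finsupp.single_apply]
    split_ifs <;> subst_vars <;> first | omega | exact absurd rfl hne

variable (K : Type w) [Field K] (H : SimpleGraph P) {W : Set P} {x : P}

theorem X_mul_mem_stanleyReisnerIdeal_iff (hx : x ∈ W) (p : MvPolynomial P K) :
    X x * p ∈ stanleyReisnerIdeal K (indepComplexOn H W) ↔
      p ∈ stanleyReisnerIdeal K (indepComplexOn H (W \ H.neighborSet x)) := by
  classical
  have hface : ∀ m : P →₀ ℕ, (Finsupp.single x 1 + m).support ∈ (indepComplexOn H W).faces ↔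
      m.support ∈ (indepComplexOn H (W \ H.neighborSet x)).faces := by
    intro m
    have hsupp : (Finsupp.single x 1 + m).support = insert x m.support := by
      ext a
      by_cases hax : a = x
      · subst hax; simp
      · simp [hax]
    simp only [hsupp, indepComplexOn, Set.mem_ofPred_eq, Finset.coe_insert,
      isIndepSet_insert_iff, Set.insert_subset_iff, Set.subset_sdiff]
    tauto
  rw [mem_stanleyReisnerIdeal, mem_stanleyReisnerIdeal, support_X_mul]
  simp only [Finset.mem_map, addLeftEmbedding_apply, forall_exists_index, and_imp,
    forall_apply_eq_imp_iff₂, hface]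

theorem stanleyReisnerIdeal_diff_singleton :
    stanleyReisnerIdeal K (indepComplexOn H (W \ {x})) =
      stanleyReisnerIdeal K (indepComplexOn H W) ⊔ Ideal.span {X x} := by
  rw [← deletion_indepComplexOn]
  apply le_antisymm
  · refine Ideal.span_le.2 ?_
    rintro _ ⟨m, hm, rfl⟩
    by_cases hx : x ∈ m.support
    · refine Ideal.mem_sup_right (Ideal.mem_span_singleton.2 ?_)
      refine monomial_dvd_monomial.2 ⟨Or.inr ?_, one_dvd _⟩
      exact Finsupp.single_le_iff.2 (Nat.one_le_iff_ne_zero.2 (Finsupp.mem_support_iff.1 hx))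
    · exact Ideal.mem_sup_left (Ideal.subset_span ⟨m, fun h => hm ⟨h, hx⟩, rfl⟩)
  · refine sup_le (Ideal.span_mono (Set.image_mono fun m hm h => hm h.1)) ?_
    rw [Ideal.span_singleton_le_iff_mem]
    exact Ideal.subset_span ⟨Finsupp.single x 1, fun h => h.2 (by simp), rfl⟩

end StanleyReisner

/-! ### A system of parameters of the edge ring -/

section Parameters

open MvPolynomial

variable {P : Type u} {V : Type v} [Fintype P] (K : Type w) [Field K]

open Classical in
/-- The sum `θ_i` of the variables of colour `i`. -/
noncomputable def colorSum (c : P → V) (i : V) : MvPolynomial P K :=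
  ∑ p with c p = i, X p

variable {K} {H : SimpleGraph P} {c : P → V} {W : Set P}

/-- If `W` is an independent transversal of the colour classes, the Stanley–Reisner ring of the
complex on `W` is the polynomial ring in the colours, and `θ_i` acts on it as the variable `i`. -/
theorem isWeaklyRegular_of_bijOn (hbij : Set.BijOn c W Set.univ)
    (hadj : ∀ p ∈ W, ∀ q ∈ W, ¬ H.Adj p q) (f : V → Polynomial K) {l : List V}
    (hl : IsWeaklyRegular (MvPolynomial V K)
      (l.map fun i => Polynomial.aeval (X i : MvPolynomial V K) (f i))) :
    IsWeaklyRegular (MvPolynomial P K ⧸ stanleyReisnerIdeal K (indepComplexOn H W))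
      (l.map fun i => Polynomial.aeval (colorSum K c i) (f i)) := by
  classical
  set I := stanleyReisnerIdeal K (indepComplexOn H W)
  choose b hbW hb using fun i => hbij.surjOn (Set.mem_univ i)
  have hbc : ∀ p ∈ W, b (c p) = p := fun p hp => hbij.injOn (hbW _) hp (hb _)
  let φ : MvPolynomial P K →ₐ[K] MvPolynomial V K := aeval fun p => if p ∈ W then X (c p) else 0
  let ψ : MvPolynomial V K →ₐ[K] MvPolynomial P K := aeval fun i => X (b i)
  have hφψ : ∀ q, φ (ψ q) = q := fun q => by
    have : φ.comp ψ = AlgHom.id K _ := algHom_ext fun i => by simp [φ, ψ, hbW, hb]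
    exact DFunLike.congr_fun this q
  have hφI : ∀ p ∈ I, φ p = 0 := by
    suffices I ≤ RingHom.ker φ from fun p hp => this hp
    refine Ideal.span_le.2 ?_
    rintro _ ⟨m, hm, rfl⟩
    have : ∃ p ∈ m.support, p ∉ W := by
      by_contra! hcon
      exact hm ⟨hcon, fun p hp q hq _ => hadj p (hcon p hp) q (hcon q hq)⟩
    obtain ⟨p, hp, hpW⟩ := this
    simp only [SetLike.mem_coe, RingHom.mem_ker, φ, aeval_monomial]
    refine mul_eq_zero_of_right _ (Finset.prod_eq_zero hp ?_)
    simp [hpW, Finsupp.mem_support_iff.1 hp]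
  have hψφ : ∀ p, Ideal.Quotient.mk I (ψ (φ p)) = Ideal.Quotient.mk I p := fun p => by
    have : (Ideal.Quotient.mkₐ K I).comp (ψ.comp φ) = Ideal.Quotient.mkₐ K I := by
      refine algHom_ext fun p => ?_
      by_cases hp : p ∈ W
      · simp [φ, ψ, hp, hbc]
      · have : Ideal.Quotient.mk I (X p) = 0 := Ideal.Quotient.eq_zero_iff_mem.2
          (Ideal.subset_span ⟨Finsupp.single p 1, fun h => hp (h.1 (by simp)), rfl⟩)
        simp [φ, hp, this]
    exact DFunLike.congr_fun this p
  let e : (MvPolynomial P K ⧸ I) ≃+* MvPolynomial V K :=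
    RingEquiv.ofBijective (Ideal.Quotient.lift I φ.toRingHom hφI) <| by
      constructor
      · rw [injective_iff_map_eq_zero]
        intro p hp
        obtain ⟨p, rfl⟩ := Ideal.Quotient.mk_surjective p
        rw [← hψφ p, show φ p = 0 from hp, map_zero, map_zero]
      · exact fun q => ⟨Ideal.Quotient.mk I (ψ q), hφψ q⟩
  refine (e.toAddEquiv.isWeaklyRegular_congr ?_).2 hl
  rw [List.forall₂_map_left_iff, List.forall₂_map_right_iff, List.forall₂_same]
  intro i _ p
  obtain ⟨p, rfl⟩ := Ideal.Quotient.mk_surjective p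
  have hθ : φ (colorSum K c i) = X i := by
    rw [colorSum, map_sum, Finset.sum_eq_single_of_mem (b i) (by simp [hb])]
    · simp [φ, hbW, hb]
    · intro p hp hne
      have hpW : p ∉ W := fun hpW => hne (by rw [← hbc p hpW, (Finset.mem_filter.1 hp).2])
      simp [φ, hpW]
  change φ (Polynomial.aeval (colorSum K c i) (f i) * p) = _ * φ p
  rw [map_mul, ← Polynomial.aeval_algHom_apply, hθ]

/-- Polynomials in the sums `θ_i` which form a weakly regular sequence for variables in place of the
`θ_i` do so on the Stanley–Reisner ring, by induction on `W` along the colon sequences of the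
shedding vertices. -/
theorem IsSimplicialPartition.isWeaklyRegular (h : IsSimplicialPartition H c W Set.univ)
    (f : V → Polynomial K) {l : List V}
    (hl : IsWeaklyRegular (MvPolynomial V K)
      (l.map fun i => Polynomial.aeval (X i : MvPolynomial V K) (f i))) :
    IsWeaklyRegular (MvPolynomial P K ⧸ stanleyReisnerIdeal K (indepComplexOn H W))
      (l.map fun i => Polynomial.aeval (colorSum K c i) (f i)) := by
  induction W using WellFoundedLT.induction with
  | ind W ih =>
  by_cases hinj : Set.InjOn c W
  · refine isWeaklyRegular_of_bijOn ⟨fun _ _ => trivial, hinj, fun i _ => ?_⟩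
      (fun p hp q hq => h.not_adj_of_injOn hinj hp hq) f hl
    obtain ⟨b, hbW, hb, -⟩ := h.exists_simplicial i trivial
    exact ⟨b, hbW, hb⟩
  · obtain ⟨x, hx, b, hbW, hbx, hc, hb⟩ := h.exists_shed hinj
    exact isWeaklyRegular_quotient_of_colon (X_mul_mem_stanleyReisnerIdeal_iff K H hx)
      (stanleyReisnerIdeal_diff_singleton K H)
      (ih _ ⟨Set.sdiff_subset, fun hle => (hle hbW).2 (h.adj_of_eq hc.symm hbx.symm)⟩
        (h.diff_neighborSet hx))
      (ih _ ⟨Set.sdiff_subset, fun hle => (hle hx).2 rfl⟩ (h.diff_singleton hbW hbx hc hb))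

/-- Modulo the edge ideal, `x_p ^ 2 = x_p θ_{c p}`, so the variable `x_p` is integral over
`K[θ]`. -/
theorem X_mul_sub_colorSum_mem_edgeIdeal (hadj : ∀ ⦃p q⦄, c p = c q → p ≠ q → H.Adj p q) (p : P) :
    X p * (X p - colorSum K c (c p)) ∈ edgeIdeal K H := by
  classical
  have : X p - colorSum K c (c p) = -∑ q ∈ (Finset.univ.filter fun q => c q = c p).erase p, X q := by
    rw [colorSum, ← Finset.add_sum_erase _ _ (a := p) (by simp)]
    ring
  rw [this, mul_neg, Finset.mul_sum]
  refine neg_mem (sum_mem fun q hq => Ideal.subset_span ⟨p, q, hadj ?_ ?_, rfl⟩)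
  · exact ((Finset.mem_filter.1 (Finset.mem_of_mem_erase hq)).2).symm
  · exact (Finset.ne_of_mem_erase hq).symm

/-- A domain generated by the image of the edge ring is a field once each `θ_i` is algebraic in it,
since every variable maps to `0` or to the image of some `θ_i`. -/
theorem isField_of_aeval_colorSum_eq_zero (hadj : ∀ ⦃p q⦄, c p = c q → p ≠ q → H.Adj p q)
    {B : Type*} [CommRing B] [IsDomain B] [Algebra K B] {π : MvPolynomial P K →ₐ[K] B}
    (hπ : Surjective π) (hker : edgeIdeal K H ≤ RingHom.ker π) {f : V → Polynomial K}
    (hf : ∀ i, (f i).Monic) (h0 : ∀ i, π (Polynomial.aeval (colorSum K c i) (f i)) = 0) :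
    IsField B := by
  have hθ : ∀ i, IsIntegral K (π (colorSum K c i)) := fun i => ⟨f i, hf i, by
    rw [← Polynomial.aeval_def, Polynomial.aeval_algHom_apply, h0]⟩
  have hX : ∀ p, IsIntegral K (π (X p)) := fun p => by
    have h : π (X p * (X p - colorSum K c (c p))) = 0 :=
      hker (X_mul_sub_colorSum_mem_edgeIdeal hadj p)
    rw [map_mul, map_sub, mul_eq_zero, sub_eq_zero] at h
    rcases h with h | h
    · rw [h]; exact isIntegral_zero
    · rw [h]; exact hθ _
  have hint : Algebra.IsIntegral K B := ⟨fun y => by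
    obtain ⟨y, rfl⟩ := hπ y
    induction y using MvPolynomial.induction_on with
    | C a => exact (π.commutes a).symm ▸ isIntegral_algebraMap
    | add p q hp hq => rw [map_add]; exact hp.add hq
    | mul_X p i hp => rw [map_mul]; exact hp.mul (hX i)⟩
  exact isField_of_isIntegral_of_isField' (Field.toIsField K)

theorem isMaximal_of_aeval_colorSum_mem (hadj : ∀ ⦃p q⦄, c p = c q → p ≠ q → H.Adj p q)
    {f : V → Polynomial K} (hf : ∀ i, (f i).Monic) {Q : Ideal (MvPolynomial P K ⧸ edgeIdeal K H)}
    [Q.IsPrime] (hQ : ∀ i, Ideal.Quotient.mk (edgeIdeal K H)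
      (Polynomial.aeval (colorSum K c i) (f i)) ∈ Q) : Q.IsMaximal := by
  have hfield := isField_of_aeval_colorSum_eq_zero hadj
    (B := (MvPolynomial P K ⧸ edgeIdeal K H) ⧸ Q)
    (π := (Ideal.Quotient.mkₐ K Q).comp (Ideal.Quotient.mkₐ K (edgeIdeal K H)))
    ((Ideal.Quotient.mkₐ_surjective K Q).comp (Ideal.Quotient.mkₐ_surjective K _))
    (fun p hp => ?_) hf fun i => Ideal.Quotient.eq_zero_iff_mem.2 (hQ i)
  · exact Ideal.Quotient.maximal_of_isField Q hfield
  · change Ideal.Quotient.mk Q (Ideal.Quotient.mk _ p) = 0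
    rw [Ideal.Quotient.eq_zero_iff_mem.2 hp, map_zero]

/-- By Zariski's lemma every element of `R` is algebraic modulo a maximal ideal. -/
theorem exists_monic_aeval_mem {R : Type*} [CommRing R] [Algebra K R] [Algebra.FiniteType K R]
    (M : Ideal R) [M.IsMaximal] (r : R) :
    ∃ f : Polynomial K, f.Monic ∧ Polynomial.aeval r f ∈ M := by
  let := Ideal.Quotient.field M
  have : Module.Finite K (R ⧸ M) := finite_of_finite_type_of_isJacobsonRing K (R ⧸ M)
  obtain ⟨f, hf, h0⟩ := Algebra.IsIntegral.isIntegral (R := K) (Ideal.Quotient.mk M r)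
  refine ⟨f, hf, Ideal.Quotient.eq_zero_iff_mem.1 ?_⟩
  rw [← Polynomial.aeval_def] at h0
  rw [← h0]
  exact (Polynomial.aeval_algHom_apply (Ideal.Quotient.mkₐ K M) r f).symm

end Parameters

/-! ### The Cohen–Macaulay property -/

theorem localDepth_le_ringKrullDim (R : Type u) [CommRing R] [IsLocalRing R] [IsNoetherianRing R] :
    (localDepth R : WithBot ℕ∞) ≤ ringKrullDim R := by
  have hbot : ringKrullDim R ≠ ⊥ := ringKrullDim_ne_bot
  obtain ⟨d, hd⟩ := WithBot.ne_bot_iff_exists.1 hbot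
  rw [← hd, WithBot.coe_le_coe]
  refine iSup_le fun ⟨rs, _, hrs⟩ => ?_
  have h := ringKrullDim_add_length_eq_ringKrullDim_of_isRegular rs hrs
  have hnt : Nontrivial (R ⧸ Ideal.ofList rs) := by
    refine Ideal.Quotient.nontrivial_iff.2 fun e => hrs.top_ne_smul ?_
    rw [e, smul_eq_mul, Ideal.mul_top]
  rw [← WithBot.coe_le_coe, hd, ← h]
  exact le_add_of_nonneg_left ringKrullDim_nonneg_of_nontrivial

/-- At a maximal ideal `M`, both the depth and the dimension equal the number of colours: for monic
`f_i` with `f_i(θ_i) ∈ M`, the `f_i(θ_i)` form a regular sequence over which `M` is minimal. -/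
theorem IsSimplicialPartition.isCohenMacaulayOver {P : Type u} {V : Type v} [Finite P]
    {H : SimpleGraph P} {c : P → V} (h : IsSimplicialPartition H c Set.univ Set.univ)
    (K : Type w) [Field K] : IsCohenMacaulayOver K H := by
  classical
  have := Fintype.ofFinite P
  have hsurj : Surjective c := fun i => by
    obtain ⟨b, -, hb, -⟩ := h.exists_simplicial i trivial
    exact ⟨b, hb⟩
  have : Finite V := Finite.of_surjective c hsurj
  have hnoeth : IsNoetherianRing (MvPolynomial P K ⧸ edgeIdeal K H) := inferInstance
  refine ⟨hnoeth, fun M hM => ?_⟩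
  choose f hf hfM using fun i => exists_monic_aeval_mem (K := K) M
    (Ideal.Quotient.mk (edgeIdeal K H) (colorSum K c i))
  have hmk : ∀ i, Polynomial.aeval (Ideal.Quotient.mk (edgeIdeal K H) (colorSum K c i)) (f i) =
      Ideal.Quotient.mk (edgeIdeal K H) (Polynomial.aeval (colorSum K c i) (f i)) := fun i =>
    Polynomial.aeval_algHom_apply (Ideal.Quotient.mkₐ K (edgeIdeal K H)) _ _
  simp only [hmk] at hfM
  obtain ⟨l, hl, hreg⟩ := exists_isWeaklyRegular_aeval_X K V f hf
  have hreg' := h.isWeaklyRegular f hreg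
  rw [← edgeIdeal_eq_stanleyReisnerIdeal,
    ← isWeaklyRegular_map_algebraMap_iff (MvPolynomial P K ⧸ edgeIdeal K H)] at hreg'
  have hmem : ∀ r ∈ (l.map fun i => Polynomial.aeval (colorSum K c i) (f i)).map
      (algebraMap (MvPolynomial P K) (MvPolynomial P K ⧸ edgeIdeal K H)), r ∈ M := by
    simp only [List.map_map, List.mem_map, forall_exists_index, and_imp]
    rintro _ i _ rfl
    exact hfM i
  have hregM := hreg'.isRegular_of_isLocalization_of_mem (Localization.AtPrime M) M hmem
  have hlower : ((Nat.card V : ℕ∞)) ≤ localDepth (Localization.AtPrime M) := by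
    refine le_trans (le_of_eq ?_) (le_iSup _ ⟨_, fun r hr => ?_, hregM⟩)
    · simp [hl]
    · obtain ⟨s, hs, rfl⟩ := List.mem_map.1 hr
      exact (IsLocalization.AtPrime.to_map_mem_maximal_iff _ M s).2 (hmem s hs)
  have hupper : M.height ≤ Nat.card V := by
    let S : Set (MvPolynomial P K ⧸ edgeIdeal K H) :=
      Set.range fun i => Ideal.Quotient.mk (edgeIdeal K H) (Polynomial.aeval (colorSum K c i) (f i))
    have hmin : M ∈ (Ideal.span S).minimalPrimes := by
      refine ⟨⟨hM.isPrime, Ideal.span_le.2 (Set.range_subset_iff.2 hfM)⟩, ?_⟩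
      rintro Q ⟨hQ, hSQ⟩ hQM
      have := isMaximal_of_aeval_colorSum_mem h.adj_of_eq hf (Q := Q)
        fun i => hSQ (Ideal.subset_span ⟨i, rfl⟩)
      exact (this.eq_of_le hM.ne_top hQM).ge
    refine (Ideal.height_le_card_of_mem_minimalPrimes_span (Set.toFinite S) hmin).trans ?_
    have hS : S.ncard ≤ Nat.card V := by
      rw [← Nat.card_coe_set_eq]
      exact Finite.card_range_le _
    exact_mod_cast hS
  refine le_antisymm (localDepth_le_ringKrullDim _) ?_
  rw [IsLocalization.AtPrime.ringKrullDim_eq_height M, WithBot.coe_le_coe]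
  exact hupper.trans hlower

/-! ### Graphs with attached complete graphs -/

theorem isSimplicialPartition_attachComplete {V : Type*} (G : SimpleGraph V) {k : V → ℕ}
    (hk : ∀ i, 2 ≤ k i) :
    IsSimplicialPartition (attachComplete G k) Sigma.fst Set.univ Set.univ where
  adj_of_eq _ _ hpq hne := Or.inl ⟨hpq, hne⟩
  color_mem _ _ := trivial
  exists_simplicial i _ := by
    -- every vertex of the attached complete graph other than `x_i` is simplicial
    refine ⟨⟨i, ⟨1, hk i⟩⟩, trivial, rfl, ?_⟩
    rintro q - (⟨h, -⟩ | ⟨-, h, -⟩)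
    · exact h.symm
    · exact absurd h one_ne_zero

end CliqueAttach

theorem theorem1p1 {V : Type*} [Finite V] (G : SimpleGraph V) (k : V → ℕ) (hk : ∀ i, 2 ≤ k i) :
    CliqueAttach.IsUnmixed (CliqueAttach.attachComplete G k) ∧
    CliqueAttach.IsVertexDecomposable (CliqueAttach.attachComplete G k) ∧
    CliqueAttach.IsShellable (CliqueAttach.attachComplete G k) ∧
    ∀ (K : Type*) [Field K],
      CliqueAttach.IsCohenMacaulayOver K (CliqueAttach.attachComplete G k) := by
  have h := CliqueAttach.isSimplicialPartition_attachComplete G hk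
  have hvd : CliqueAttach.IsVertexDecomposable (CliqueAttach.attachComplete G k) := by
    rw [CliqueAttach.IsVertexDecomposable, CliqueAttach.cliqueComplex_compl]
    exact h.isVertexDecomposable_indepComplexOn
  exact ⟨h.isUnmixed, hvd, hvd.isShellable, fun K _ => h.isCohenMacaulayOver K⟩
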